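/- Let $G$ be a finite simple graph, and let $\alpha(G)$ denote its independence number, i.e. the largest size of a set of vertices of $G$ that contains no edge. If $G$ is Hamiltonian (it has a cycle passing through all of its vertices) and $|V(G)| \ge 150\,\alpha(G)^3$, then $G$ is pancyclic: for every integer $\ell$ with $3 \le \ell \le |V(G)|$, $G$ contains a cycle of length $\ell$. -/

import Mathlib

/-- A graph on `n` vertices is pancyclic if it contains a cycle of length `ℓ` for every
`3 ≤ ℓ ≤ n`. -/
def SimpleGraph.IsPancyclic {V : Type*} [Fintype V] (G : SimpleGraph V) : Prop :=
  ∀ ℓ : ℕ, 3 ≤ ℓ → ℓ ≤ Fintype.card V →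
    ∃ (v : V) (c : G.Walk v v), c.IsCycle ∧ c.length = ℓ

/-! Write k for the independence number. Each length falls into one of three ranges, with a separate
mechanism for each.

Long cycles (at least `(2 * k + 1) * (3 * k * k + 1)`). The Hamilton cycle is viewed as a path with
adjacent ends, which is shortened one vertex at a time with its ends fixed. Among 2k+1 consecutive
vertices some chord skips between 1 and 2k-1 of them. If these have many neighbours on the path, all
but one can be put back by the Chvátal–Erdős successor argument (`IsPathList.extend`,
`IsPathList.insert_many`). This is `IsPathList.exists_length_pred`.

Middle lengths (from 8k² up to 12k³). Chords alone reach a target only up to an error below 2k. A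
minimal dense set inside a short segment of the cycle is highly connected, hence Hamilton-connected,
and yields a short path together with a reservoir of 2k vertices insertable into it
(`IsMinDenseSet.exists_flexible`). Closing that path with a shortened complementary arc and
inserting reservoir vertices gives the exact length.

Short cycles (below 8k²). Hamiltonicity is not needed: this is the Ramsey bound
`exists_isCycle_of_card_lt`. Without an n-cycle, every early breadth-first level has an independent
subset of proportion 1/(n-2). If independent sets expand, the levels then grow until such a subset
is too large. -/

namespace SimpleGraph

/-! ### Paths as vertex lists. -/

variable {V : Type*} {G : SimpleGraph V}

/-- `G.IsPathList x y l` says that `l` lists the vertices of a path of `G` from `x` to `y`. -/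
structure IsPathList (G : SimpleGraph V) (x y : V) (l : List V) : Prop where
  nodup : l.Nodup
  chain : l.IsChain G.Adj
  head : l.head? = some x
  last : l.getLast? = some y

namespace IsPathList

variable {x y a b u v : V} {l l₁ l₂ p q m : List V}

lemma ne_nil (h : G.IsPathList x y l) : l ≠ [] := by
  have := h.head
  grind

lemma length_pos (h : G.IsPathList x y l) : 0 < l.length :=
  List.length_pos_of_ne_nil h.ne_nil

lemma singleton (x : V) : G.IsPathList x x [x] :=
  ⟨by simp, by simp, by simp, by simp⟩

lemma reverse (h : G.IsPathList x y l) : G.IsPathList y x l.reverse where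
  nodup := List.nodup_reverse.2 h.nodup
  chain := List.isChain_reverse.2 (h.chain.imp fun _ _ e => e.symm)
  head := by simpa using h.last
  last := by simpa using h.head

lemma append (h₁ : G.IsPathList x a l₁) (h₂ : G.IsPathList b y l₂) (hab : G.Adj a b)
    (hd : l₁.Disjoint l₂) : G.IsPathList x y (l₁ ++ l₂) where
  nodup := h₁.nodup.append h₂.nodup hd
  chain := h₁.chain.append h₂.chain (by simp [h₁.last, h₂.head, hab])
  head := by simp [h₁.head]
  last := by simp [h₂.last]

lemma take (h : G.IsPathList x y l) {i : ℕ} (hi : i < l.length) :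
    G.IsPathList x l[i] (l.take (i + 1)) where
  nodup := h.nodup.sublist (List.take_sublist _ _)
  chain := h.chain.take _
  head := by simp [List.head?_take, h.head]
  last := by simp [List.getLast?_take, hi]

lemma drop (h : G.IsPathList x y l) {i : ℕ} (hi : i < l.length) :
    G.IsPathList l[i] y (l.drop i) where
  nodup := h.nodup.sublist (List.drop_sublist _ _)
  chain := h.chain.drop _
  head := by simp [hi]
  last := by simp [List.getLast?_drop, h.last]; omega

lemma adj_getElem (h : G.IsPathList x y l) {i : ℕ} (hi : i + 1 < l.length) :
    G.Adj l[i] l[i + 1] :=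
  h.chain.getElem i hi

/-- Replace a middle part of a path by another path with the same ends. -/
lemma replace (h : G.IsPathList x y (p ++ m ++ q)) (hm : G.IsPathList a b m)
    {m' : List V} (hm' : G.IsPathList a b m') (hsub : ∀ v ∈ m', v ∉ p ∧ v ∉ q) :
    G.IsPathList x y (p ++ m' ++ q) := by
  obtain ⟨h1, h2, h3, h4⟩ := h
  obtain ⟨m1, m2, m3, m4⟩ := hm
  obtain ⟨n1, n2, n3, n4⟩ := hm'
  refine ⟨?_, ?_, ?_, ?_⟩
  · simp only [List.nodup_append, List.mem_append] at h1 ⊢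
    grind
  · simp only [List.isChain_append, List.getLast?_append, m3, m4] at h2
    simp only [List.isChain_append, List.getLast?_append, n3, n4]
    grind
  · simpa [List.head?_append, m3, n3] using h3
  · simpa [List.getLast?_append, m4, n4] using h4

lemma exists_segment (h : G.IsPathList x y (p ++ m ++ q)) (hm : m ≠ []) :
    ∃ a b, G.IsPathList a b m := by
  refine ⟨m.head hm, m.getLast hm, ?_, ?_, ?_, ?_⟩
  · exact h.nodup.sublist (by simp)
  · exact h.chain.infix ⟨p, q, rfl⟩
  · simp [List.head?_eq_some_head hm]
  · simp [List.getLast?_eq_some_getLast hm]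

/-- A path whose ends are adjacent closes up to a cycle. -/
lemma exists_isCycle (h : G.IsPathList x y l) (hyx : G.Adj y x) (hl : 3 ≤ l.length) :
    ∃ (v : V) (c : G.Walk v v), c.IsCycle ∧ c.length = l.length := by
  have hh : l.head h.ne_nil = x := by
    have := h.head; rw [List.head?_eq_some_head h.ne_nil] at this; simpa using this
  have ht : l.getLast h.ne_nil = y := by
    have := h.last; rw [List.getLast?_eq_some_getLast h.ne_nil] at this; simpa using this
  let w : G.Walk x y := (Walk.ofSupport l h.ne_nil h.chain).copy hh ht
  have hs : w.support = l := by simp [w]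
  have hw : w.IsPath := by rw [Walk.isPath_def, hs]; exact h.nodup
  have hlen : w.length + 1 = l.length := by rw [← hs, Walk.length_support]
  refine ⟨y, Walk.cons hyx w, ?_, by simpa using hlen⟩
  rw [Walk.cons_isCycle_iff]
  refine ⟨hw, fun he => ?_⟩
  cases hcases : w with
  | nil => rw [hcases] at hlen; simp at hlen; omega
  | cons e w' =>
    rw [hcases] at he hw hlen
    rw [Walk.cons_isPath_iff] at hw
    rw [Walk.edges_cons, List.mem_cons] at he
    rcases he with he | he
    · rw [Sym2.eq_swap, Sym2.congr_right] at he
      subst he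
      have := hw.1
      rw [Walk.isPath_iff_nil] at this
      have := Walk.length_eq_zero_iff.2 this
      simp at hlen; omega
    · exact hw.2 (Walk.snd_mem_support_of_mem_edges _ he)

end IsPathList

/-! ### Shortcuts, detours and insertion of vertices. -/

variable {x y : V} {l : List V} {k : ℕ}

/-- Among more than `2 * k` vertices of a path there is a chord skipping an odd number of vertices
less than `2 * k`, if independent sets have at most `k` vertices. -/
lemma IsPathList.exists_shortcut (hα : ∀ s : Finset V, G.IsIndepSet s → s.card ≤ k)
    (h : G.IsPathList x y l) (hk : 2 * k < l.length) :
    ∃ l', G.IsPathList x y l' ∧ l'.Sublist l ∧ l'.length < l.length ∧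
      l.length < l'.length + 2 * k := by
  have key : ∃ i j, i < j ∧ j ≤ k ∧ ∃ (hi : 2 * i < l.length) (hj : 2 * j < l.length),
      G.Adj l[2 * i] l[2 * j] := by
    by_contra! hcon
    classical
    -- Even positions only: an edge between two of them is never an edge of the path, so it skips at
    -- least one vertex.
    let s : Finset V := (Finset.univ : Finset (Fin (k + 1))).image
      fun i : Fin (k + 1) => l[2 * (i : ℕ)]'(by omega)
    have hs : s.card = k + 1 := by
      rw [Finset.card_image_of_injective, Finset.card_univ, Fintype.card_fin]
      intro i j hij
      have := (h.nodup.getElem_inj_iff).1 hij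
      omega
    have := hα s ?_
    · omega
    intro u hu v hv huv hadj
    simp only [s, Finset.coe_image, Set.mem_image, Finset.coe_univ, Set.mem_univ, true_and] at hu hv
    obtain ⟨i, rfl⟩ := hu
    obtain ⟨j, rfl⟩ := hv
    rcases lt_trichotomy (i : ℕ) j with hij | hij | hij
    · exact hcon i j hij (by omega) (by omega) (by omega) hadj
    · exact huv (by simp [hij])
    · exact hcon j i hij (by omega) (by omega) (by omega) hadj.symm
  obtain ⟨i, j, hij, hjk, hi, hj, hadj⟩ := key
  refine ⟨l.take (2 * i + 1) ++ l.drop (2 * j), ?_, ?_, ?_, ?_⟩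
  · refine (h.take hi).append (h.drop hj) hadj ?_
    exact List.disjoint_take_drop h.nodup (by omega)
  · conv_rhs => rw [← List.take_append_drop (2 * i + 1) l]
    refine List.Sublist.append (List.Sublist.refl _) ?_
    exact List.drop_sublist_drop_left _ (by omega)
  · simp; omega
  · simp; omega

/-- Shortcuts lead to any window of `2 * k` consecutive lengths. -/
lemma IsPathList.exists_short (hα : ∀ s : Finset V, G.IsIndepSet s → s.card ≤ k)
    (h : G.IsPathList x y l) {t : ℕ} (ht : 2 * k ≤ t) (hk : 1 ≤ k) (htl : t ≤ l.length) :
    ∃ l', G.IsPathList x y l' ∧ l'.Sublist l ∧ l'.length ≤ t ∧ t < l'.length + 2 * k := by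
  induction hn : l.length using Nat.strong_induction_on generalizing l with
  | _ n ih =>
    rcases htl.eq_or_lt with e | e
    · exact ⟨l, h, List.Sublist.refl _, by omega, by omega⟩
    obtain ⟨l', h', hs, h1, h2⟩ := h.exists_shortcut hα (by omega)
    by_cases hc : t ≤ l'.length
    · obtain ⟨l'', g, gs, g1, g2⟩ := ih l'.length (by omega) h' hc rfl
      exact ⟨l'', g, gs.trans hs, g1, g2⟩
    · exact ⟨l', h', hs, by omega, by omega⟩

/-- A path between two consecutive vertices can be replaced by a detour. -/
lemma IsPathList.detour (h : G.IsPathList x y l) {i : ℕ} (hi : i + 1 < l.length)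
    {a b : V} {R : List V} (hR : G.IsPathList a b R) (hd : R.Disjoint l)
    (ha : G.Adj l[i] a) (hb : G.Adj b l[i + 1]) :
    ∃ l', G.IsPathList x y l' ∧ l'.Perm (R ++ l) := by
  refine ⟨l.take (i + 1) ++ R ++ l.drop (i + 1), ?_, ?_⟩
  · refine ((h.take (by omega)).append hR ha ?_).append (h.drop hi) hb ?_
    · intro v hv hv'
      exact hd hv' (List.mem_of_mem_take hv)
    · intro v hv hv'
      rcases List.mem_append.1 hv with hv | hv
      · exact List.disjoint_take_drop h.nodup le_rfl hv hv'
      · exact hd hv (List.mem_of_mem_drop hv')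
  · refine (List.perm_append_comm.append_right _).trans ?_
    rw [List.append_assoc, List.take_append_drop]

/-- Two chords between vertices `l[i]`, `l[j]` and their successors, the first of them running
through a list of new vertices. -/
lemma IsPathList.crossing_detour (h : G.IsPathList x y l) {i j : ℕ} (hij : i < j)
    (hj : j + 1 < l.length) {a b : V} {R : List V} (hR : G.IsPathList a b R) (hd : R.Disjoint l)
    (ha : G.Adj l[i] a) (hb : G.Adj b l[j]) (hs : G.Adj l[i + 1] l[j + 1]) :
    ∃ l', G.IsPathList x y l' ∧ l'.Perm (R ++ l) := by
  set m := (l.take (j + 1)).drop (i + 1) with hm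
  have hl : l = l.take (i + 1) ++ (m ++ l.drop (j + 1)) := by
    have h1 : l.take (j + 1) = l.take (i + 1) ++ m := by
      conv_lhs => rw [← List.take_append_drop (i + 1) (l.take (j + 1))]
      rw [List.take_take, min_eq_left (by omega)]
    rw [← List.append_assoc, ← h1, List.take_append_drop]
  have hmp : G.IsPathList l[i + 1] l[j] m := by
    have := (h.take (i := j) (by omega)).drop (i := i + 1) (by simp; omega)
    simpa using this
  have hn := h.nodup
  rw [hl] at hn
  simp only [List.nodup_append', List.disjoint_append_right] at hn
  -- Go to `l[i]`, through `R` to `l[j]`, backwards to `l[i + 1]`, and across the chord to `l[j +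
  -- 1]`.
  refine ⟨l.take (i + 1) ++ R ++ (m.reverse ++ l.drop (j + 1)), ?_, ?_⟩
  · refine ((h.take (by omega)).append hR ha ?_).append
      (hmp.reverse.append (h.drop hj) hs ?_) hb ?_
    · intro v hv hv'
      exact hd hv' (List.mem_of_mem_take hv)
    · intro v hv hv'
      exact hn.2.1.2.2 (List.mem_reverse.1 hv) hv'
    · intro v hv hv'
      have hv2 : v ∈ m ++ l.drop (j + 1) := by simpa using hv'
      rcases List.mem_append.1 hv with hv | hv
      · rcases List.mem_append.1 hv2 with h2 | h2
        · exact hn.2.2.1 hv h2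
        · exact hn.2.2.2 hv h2
      · refine hd hv ?_
        rw [hl]
        exact List.mem_append_right _ hv2
  · have h1 : (l.take (i + 1) ++ R ++ (m.reverse ++ l.drop (j + 1))).Perm
        (R ++ l.take (i + 1) ++ (m ++ l.drop (j + 1))) :=
      List.perm_append_comm.append ((List.reverse_perm m).append_right _)
    rw [List.append_assoc R, ← hl] at h1
    exact h1

/-- A path with more than `k` neighbours of a connected set `C` outside it can be extended through
`C`, if independent sets have at most `k` vertices. -/
lemma IsPathList.extend (hα : ∀ s : Finset V, G.IsIndepSet s → s.card ≤ k)
    (h : G.IsPathList x y l) {C : Set V} (hC : ∀ v ∈ C, v ∉ l)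
    (hconn : ∀ a ∈ C, ∀ b ∈ C, ∃ R, G.IsPathList a b R ∧ ∀ c ∈ R, c ∈ C)
    {s : Finset V} (hs : ∀ u ∈ s, u ∈ l ∧ ∃ c ∈ C, G.Adj u c) (hk : k < s.card) :
    ∃ R l', R ≠ [] ∧ R.Nodup ∧ (∀ c ∈ R, c ∈ C) ∧ G.IsPathList x y l' ∧ l'.Perm (R ++ l) := by
  classical
  have hidx : ∀ u ∈ s.erase y, l.idxOf u + 1 < l.length := by
    intro u hu
    obtain ⟨huy, hu⟩ := Finset.mem_erase.1 hu
    have h1 := List.idxOf_lt_length_of_mem (hs u hu).1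
    by_contra hcon
    apply huy
    have h2 := h.last
    rw [List.getLast?_eq_getElem?, show l.length - 1 = l.idxOf u by omega] at h2
    simpa [h1] using h2
  -- Successor on the path. The end `y` has none, hence `s.erase y`; the default `x` never occurs
  -- there.
  let f : V → V := fun u => l.getD (l.idxOf u + 1) x
  have hf : ∀ u (hu : u ∈ s.erase y), f u = l[l.idxOf u + 1]'(hidx u hu) := by
    intro u hu
    exact List.getD_eq_getElem _ _ (hidx u hu)
  have hfl : ∀ u ∈ s.erase y, f u ∈ l := fun u hu => by
    rw [hf u hu]; exact List.getElem_mem _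
  have hinj : Set.InjOn f (s.erase y) := by
    intro u hu v hv huv
    rw [hf u hu, hf v hv, h.nodup.getElem_inj_iff] at huv
    exact List.idxOf_inj (hs u (Finset.mem_of_mem_erase hu)).1 |>.1 (by omega)
  obtain ⟨u₀, hu₀⟩ : s.Nonempty := Finset.card_pos.1 (by omega)
  obtain ⟨-, c, hc, -⟩ := hs u₀ hu₀
  have hdisj : ∀ R : List V, (∀ c ∈ R, c ∈ C) → R.Disjoint l :=
    fun R hR v hv => hC v (hR v hv)
  have hatt : ∀ u (hu : u ∈ s.erase y), ∃ a ∈ C,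
      G.Adj (l[l.idxOf u]'(Nat.lt_of_succ_lt (hidx u hu))) a := by
    intro u hu
    simpa using (hs u (Finset.mem_of_mem_erase hu)).2
  have hfin : ∀ {a b : V} {R : List V}, G.IsPathList a b R → (∀ c ∈ R, c ∈ C) →
      (∃ l', G.IsPathList x y l' ∧ l'.Perm (R ++ l)) →
      ∃ R l', R ≠ [] ∧ R.Nodup ∧ (∀ c ∈ R, c ∈ C) ∧ G.IsPathList x y l' ∧ l'.Perm (R ++ l) :=
    fun hR hRC ⟨l', h1, h2⟩ => ⟨_, l', hR.ne_nil, hR.nodup, hRC, h1, h2⟩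
  -- At least k successors together with `c` are more than k vertices, so two are adjacent: an edge
  -- at `c` gives a detour, an edge between successors a crossing detour.
  have hadj : ∃ u ∈ s.erase y, G.Adj (f u) c ∨ ∃ v ∈ s.erase y,
      l.idxOf u < l.idxOf v ∧ G.Adj (f u) (f v) := by
    by_contra! hcon
    have hcard : (insert c ((s.erase y).image f)).card = (s.erase y).card + 1 := by
      rw [Finset.card_insert_of_notMem, Finset.card_image_of_injOn hinj]
      intro hmem
      obtain ⟨u, hu, rfl⟩ := Finset.mem_image.1 hmem
      exact hC _ hc (hfl u hu)
    have hle := hα (insert c ((s.erase y).image f)) ?_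
    · have := Finset.pred_card_le_card_erase (s := s) (a := y)
      omega
    intro p hp q hq hpq hadj
    simp only [Finset.coe_insert, Set.mem_insert_iff, Finset.mem_coe, Finset.mem_image] at hp hq
    rcases hp with rfl | ⟨u, hu, rfl⟩ <;> rcases hq with rfl | ⟨v, hv, rfl⟩
    · exact hpq rfl
    · exact (hcon v hv).1 hadj.symm
    · exact (hcon u hu).1 hadj
    · rcases lt_trichotomy (l.idxOf u) (l.idxOf v) with e | e | e
      · exact (hcon u hu).2 v hv e hadj
      · exact hpq (by simp [f, e])
      · exact (hcon v hv).2 u hu e hadj.symm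
  obtain ⟨u, hu, hadj | ⟨v, hv, huv, hadj⟩⟩ := hadj
  · obtain ⟨a, ha, hua⟩ := hatt u hu
    obtain ⟨R, hR, hRC⟩ := hconn a ha c hc
    rw [hf u hu] at hadj
    exact hfin hR hRC (h.detour (hidx u hu) hR (hdisj R hRC) hua hadj.symm)
  · obtain ⟨a, ha, hua⟩ := hatt u hu
    obtain ⟨b, hb, hvb⟩ := hatt v hv
    obtain ⟨R, hR, hRC⟩ := hconn a ha b hb
    rw [hf u hu, hf v hv] at hadj
    exact hfin hR hRC
      (h.crossing_detour huv (hidx v hv) hR (hdisj R hRC) hua hvb.symm hadj)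

/-- A vertex with more than `k` neighbours on a path can be inserted into it, if independent sets
have at most `k` vertices. -/
lemma IsPathList.insert [DecidableRel G.Adj] [DecidableEq V]
    (hα : ∀ s : Finset V, G.IsIndepSet s → s.card ≤ k)
    (h : G.IsPathList x y l) {z : V} (hz : z ∉ l)
    (hk : k < (l.toFinset.filter fun v => G.Adj z v).card) :
    ∃ l', G.IsPathList x y l' ∧ l'.Perm (z :: l) := by
  obtain ⟨R, l', hne, hnd, hR, hl', hp⟩ := h.extend hα (C := {z}) (by simpa using hz)
    (by
      rintro _ rfl _ rfl
      exact ⟨_, .singleton _, by simp⟩)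
    (s := l.toFinset.filter fun v => G.Adj z v) (by
      intro u hu
      simp only [Finset.mem_filter, List.mem_toFinset] at hu
      exact ⟨hu.1, z, rfl, hu.2.symm⟩) hk
  have : R = [z] := by
    cases R with
    | nil => exact absurd rfl hne
    | cons a R =>
      have ha : a = z := hR a (by simp)
      cases R with
      | nil => rw [ha]
      | cons b R =>
        have hb : b = z := hR b (by simp)
        simp [ha, hb] at hnd
  subst this
  exact ⟨l', hl', hp⟩

/-- Vertices with more than `k` neighbours on a path can be inserted into it one after another. -/
lemma IsPathList.insert_many [DecidableRel G.Adj] [DecidableEq V]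
    (hα : ∀ s : Finset V, G.IsIndepSet s → s.card ≤ k)
    (h : G.IsPathList x y l) (Z : Finset V) (hZ : ∀ z ∈ Z, z ∉ l)
    (hk : ∀ z ∈ Z, k < (l.toFinset.filter fun v => G.Adj z v).card) :
    ∃ l', G.IsPathList x y l' ∧ l'.toFinset = l.toFinset ∪ Z ∧ l'.length = l.length + Z.card := by
  induction Z using Finset.induction_on with
  | empty => exact ⟨l, h, by simp, by simp⟩
  | insert z Z hzZ ih =>
    obtain ⟨l₁, h₁, hs, hl⟩ := ih (fun w hw => hZ w (by simp [hw])) (fun w hw => hk w (by simp [hw]))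
    have hz₁ : z ∉ l₁ := by
      rw [← List.mem_toFinset, hs]
      simp [hZ z (by simp), hzZ]
    obtain ⟨l₂, h₂, hp⟩ := h₁.insert hα hz₁ ((hk z (by simp)).trans_le (Finset.card_le_card
      (Finset.filter_subset_filter _ (by rw [hs]; exact Finset.subset_union_left))))
    refine ⟨l₂, h₂, ?_, ?_⟩
    · rw [List.toFinset_eq_of_perm _ _ hp, List.toFinset_cons, hs]
      ext; simp
    · rw [hp.length_eq, List.length_cons, hl, Finset.card_insert_of_notMem hzZ]; omega

end SimpleGraph

/-! ### Degenerate sets and long cycles. -/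

namespace SimpleGraph

variable {V : Type*} {G : SimpleGraph V} [DecidableEq V] [DecidableRel G.Adj]
  {x y : V} {l : List V} {k : ℕ}

/-- If every nonempty subset of `S` induces a vertex of degree less than `d`, then `S` contains
an independent set of at least `|S| / d` vertices. -/
lemma exists_isIndepSet_of_degenerate {d : ℕ} (S : Finset V)
    (h : ∀ T ⊆ S, T.Nonempty → ∃ v ∈ T, (T.filter fun w => G.Adj v w).card < d) :
    ∃ I ⊆ S, G.IsIndepSet I ∧ S.card ≤ d * I.card := by
  induction S using Finset.strongInduction with
  | H S ih =>
    rcases S.eq_empty_or_nonempty with rfl | hne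
    · exact ⟨∅, by simp, by simp [IsIndepSet], by simp⟩
    obtain ⟨v, hv, hd⟩ := h S subset_rfl hne
    -- Greedy choice: taking `v` costs its closed neighbourhood, at most `d` vertices.
    set N := insert v (S.filter fun w => G.Adj v w) with hN
    have hNS : N ⊆ S := Finset.insert_subset hv (Finset.filter_subset _ _)
    have hlt : S \ N ⊂ S := by
      refine Finset.ssubset_iff_subset_ne.2 ⟨Finset.sdiff_subset, fun e => ?_⟩
      have : v ∈ S \ N := by rw [e]; exact hv
      simp [hN] at this
    obtain ⟨I, hI, hind, hcard⟩ := ih (S \ N) hlt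
      fun T hT hTne => h T (hT.trans Finset.sdiff_subset) hTne
    have hvI : v ∉ I := fun hmem => by
      have := hI hmem
      simp [hN] at this
    refine ⟨insert v I, Finset.insert_subset hv (hI.trans Finset.sdiff_subset), ?_, ?_⟩
    · rw [Finset.coe_insert]
      refine Set.Pairwise.insert hind fun w hw _ => ?_
      have hw' := hI hw
      have : ¬ G.Adj v w := fun e => by simp [hN, e] at hw'; tauto
      exact ⟨this, fun e => this e.symm⟩
    · rw [Finset.card_insert_of_notMem hvI]
      have h1 := Finset.card_sdiff_add_card_eq_card hNS
      have h2 : N.card ≤ (S.filter fun w => G.Adj v w).card + 1 := Finset.card_insert_le _ _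
      rw [mul_add, mul_one]
      omega

/-- A set of more than `d * a` vertices without independent sets of more than `a` vertices
contains a nonempty subset of minimum degree at least `d`. -/
lemma exists_subset_le_degree {d a : ℕ} (S : Finset V)
    (hα : ∀ I ⊆ S, G.IsIndepSet I → I.card ≤ a) (hS : d * a < S.card) :
    ∃ T ⊆ S, T.Nonempty ∧ ∀ v ∈ T, d ≤ (T.filter fun w => G.Adj v w).card := by
  by_contra! hcon
  obtain ⟨I, hI, hind, hcard⟩ := exists_isIndepSet_of_degenerate S hcon
  have := Nat.mul_le_mul_left d (hα I hI hind)
  omega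

/-- A path with sufficiently many vertices can be shortened by one vertex. -/
lemma IsPathList.exists_length_pred (hα : ∀ s : Finset V, G.IsIndepSet s → s.card ≤ k)
    (hk : 1 ≤ k) (h : G.IsPathList x y l) (hl : (2 * k + 1) * (3 * k * k + 1) ≤ l.length) :
    ∃ l', G.IsPathList x y l' ∧ l'.length + 1 = l.length := by
  -- Low-degree vertices form a degenerate set, so there are at most 3k² of them, and one of 3k²+1
  -- disjoint blocks of 2k+1 vertices avoids them.
  set L := l.toFinset.filter fun v => (l.toFinset.filter fun w => G.Adj v w).card < 3 * k with hL
  have hLcard : L.card ≤ 3 * k * k := by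
    obtain ⟨I, -, hI, hc⟩ := exists_isIndepSet_of_degenerate (G := G) (d := 3 * k) L fun T hT hTne => by
      obtain ⟨v, hv⟩ := hTne
      refine ⟨v, hv, lt_of_le_of_lt (Finset.card_le_card ?_) (Finset.mem_filter.1 (hT hv)).2⟩
      exact Finset.filter_subset_filter _ (hT.trans (Finset.filter_subset _ _))
    exact hc.trans (Nat.mul_le_mul_left _ (hα I hI))
  obtain ⟨i, hi, hib⟩ : ∃ i < 3 * k * k + 1, ∀ j (hj : j < l.length),
      (2 * k + 1) * i ≤ j → j < (2 * k + 1) * i + (2 * k + 1) → l[j] ∉ L := by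
    by_contra! hcon
    choose! g hg1 hg2 hg3 hg4 using hcon
    let f : Fin (3 * k * k + 1) → V := fun i => l[g i]'(hg1 i i.2)
    have hf : Function.Injective f := by
      intro i j hij
      have e : g i = g j := (h.nodup.getElem_inj_iff).1 hij
      have h1 : g i / (2 * k + 1) = i := by
        apply Nat.div_eq_of_lt_le
        · have := hg2 i i.2; linarith
        · have := hg3 i i.2; linarith
      have h2 : g j / (2 * k + 1) = j := by
        apply Nat.div_eq_of_lt_le
        · have := hg2 j j.2; linarith
        · have := hg3 j j.2; linarith
      exact Fin.ext (by rw [← h1, ← h2, e])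
    have := Finset.card_le_card (s := Finset.univ.image f) (t := L) (by
      intro v hv
      obtain ⟨i, -, rfl⟩ := Finset.mem_image.1 hv
      exact hg4 i i.2)
    rw [Finset.card_image_of_injective _ hf, Finset.card_univ, Fintype.card_fin] at this
    omega
  have hlen : (2 * k + 1) * i + (2 * k + 1) ≤ l.length := by
    have : (2 * k + 1) * (i + 1) ≤ (2 * k + 1) * (3 * k * k + 1) := Nat.mul_le_mul_left _ hi
    linarith
  set n := (2 * k + 1) * i with hn
  set p := l.take n with hp
  set b := (l.drop n).take (2 * k + 1) with hb
  set q := (l.drop n).drop (2 * k + 1) with hq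
  have hl : l = p ++ b ++ q := by
    rw [List.append_assoc, List.take_append_drop, List.take_append_drop]
  have hblen : b.length = 2 * k + 1 := by simp [hb]; omega
  have hbL : ∀ v ∈ b, v ∉ L := by
    intro v hv
    obtain ⟨j, hj, rfl⟩ := List.getElem_of_mem hv
    have e : b[j] = l[n + j]'(by omega) := by simp [hb]
    rw [e]
    exact hib (n + j) (by omega) (by omega) (by omega)
  have hnd := h.nodup
  rw [hl] at h hnd
  obtain ⟨u, w, hbp⟩ := h.exists_segment (by intro e; simp [e] at hblen)
  obtain ⟨b', hb', hsub, hlt, hle⟩ := hbp.exists_shortcut hα (by omega)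
  simp only [List.nodup_append', List.disjoint_append_left] at hnd
  have h₁ := h.replace hbp hb' fun v hv =>
    ⟨fun hv' => hnd.1.2.2 hv' (hsub.subset hv), fun hv' => hnd.2.2.2 (hsub.subset hv) hv'⟩
  set D := b.toFinset \ b'.toFinset with hD
  have hDcard : D.card + b'.length = b.length := by
    rw [← List.toFinset_card_of_nodup hb'.nodup, ← List.toFinset_card_of_nodup hbp.nodup]
    exact Finset.card_sdiff_add_card_eq_card fun v hv => by
      simp only [List.mem_toFinset] at hv ⊢; exact hsub.subset hv
  -- All skipped vertices but one return. Each has at least 3k neighbours on the path and at most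
  -- 2k-1 of these were skipped, so more than k remain.
  obtain ⟨Z, hZD, hZ⟩ := Finset.exists_subset_card_eq (s := D) (n := D.card - 1) (by omega)
  have hZb : ∀ z ∈ Z, z ∈ b ∧ z ∉ b' := fun z hz => by
    simpa [hD] using hZD hz
  obtain ⟨l', hl', -, hll⟩ := h₁.insert_many hα Z (by
      intro z hz
      obtain ⟨h1, h2⟩ := hZb z hz
      simp only [List.mem_append, not_or]
      exact ⟨⟨fun h3 => hnd.1.2.2 h3 h1, h2⟩, fun h3 => hnd.2.2.2 h1 h3⟩) (by
      intro z hz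
      have hzb := (hZb z hz).1
      have hzl : z ∈ l := by rw [hl]; simp [hzb]
      have h1 : 3 * k ≤ (l.toFinset.filter fun w => G.Adj z w).card := by
        have := hbL z hzb
        simp only [hL, Finset.mem_filter, List.mem_toFinset, hzl, true_and, not_lt] at this
        exact this
      have h2 : (l.toFinset.filter fun w => G.Adj z w) ⊆
          ((p ++ b' ++ q).toFinset.filter fun w => G.Adj z w) ∪ D := by
        intro v hv
        simp only [hl, Finset.mem_filter, List.mem_toFinset, List.mem_append, Finset.mem_union,
          hD, Finset.mem_sdiff] at hv ⊢
        tauto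
      have h3 := (Finset.card_le_card h2).trans (Finset.card_union_le _ _)
      omega)
  refine ⟨l', hl', ?_⟩
  rw [hll, hZ]
  have : l.length = p.length + b.length + q.length := by rw [← List.length_append, ← List.length_append, ← hl]
  simp only [List.length_append]
  omega

/-- A path with many vertices can be shortened to any length that is not too small. -/
lemma IsPathList.exists_length_eq (hα : ∀ s : Finset V, G.IsIndepSet s → s.card ≤ k)
    (hk : 1 ≤ k) (h : G.IsPathList x y l) {m : ℕ} (hm : (2 * k + 1) * (3 * k * k + 1) ≤ m)
    (hml : m ≤ l.length) : ∃ l', G.IsPathList x y l' ∧ l'.length = m := by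
  induction hml using Nat.decreasingInduction with
  | self => exact ⟨l, h, rfl⟩
  | of_succ n hn ih =>
    obtain ⟨l₁, h₁, hl₁⟩ := ih (by omega)
    obtain ⟨l₂, h₂, hl₂⟩ := h₁.exists_length_pred hα hk (by omega)
    exact ⟨l₂, h₂, by omega⟩

end SimpleGraph

/-! ### Minimal dense sets and middle lengths. -/

namespace SimpleGraph

variable {V : Type*} {G : SimpleGraph V} {x y : V} {l : List V} {k : ℕ}

/-- One step along an edge inside the set `S`. -/
def StepIn (G : SimpleGraph V) (S : Set V) (u v : V) : Prop :=
  G.Adj u v ∧ u ∈ S ∧ v ∈ S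

lemma exists_isPathList_of_reflTransGen {S : Set V} {a b : V}
    (h : Relation.ReflTransGen (G.StepIn S) a b) :
    ∃ R, G.IsPathList a b R ∧ ∀ c ∈ R, Relation.ReflTransGen (G.StepIn S) a c := by
  induction h with
  | refl => exact ⟨[a], .singleton a, by simp [Relation.ReflTransGen.refl]⟩
  | @tail b c hab hbc ih =>
    obtain ⟨R, hR, hR'⟩ := ih
    by_cases hc : c ∈ R
    · obtain ⟨i, hi, rfl⟩ := List.getElem_of_mem hc
      exact ⟨_, hR.take hi, fun v hv => hR' v (List.mem_of_mem_take hv)⟩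
    · refine ⟨R ++ [c], hR.append (.singleton c) hbc.1 (by simpa using hc), ?_⟩
      intro v hv
      rcases List.mem_append.1 hv with hv | hv
      · exact hR' v hv
      · rw [List.mem_singleton.1 hv]; exact hab.tail hbc

lemma reflTransGen_stepIn_symm {S : Set V} {a b : V}
    (h : Relation.ReflTransGen (G.StepIn S) a b) : Relation.ReflTransGen (G.StepIn S) b a := by
  induction h with
  | refl => exact .refl
  | tail _ e ih => exact ih.head ⟨e.1.symm, e.2.2, e.2.1⟩

lemma mem_of_reflTransGen_stepIn {S : Set V} {a b : V}
    (h : Relation.ReflTransGen (G.StepIn S) a b) (ha : a ∈ S) : b ∈ S := by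
  cases h with
  | refl => exact ha
  | tail _ e => exact e.2.2

variable [DecidableRel G.Adj]

/-- A nonempty vertex set whose independent subsets have at most `a` vertices and which induces
a subgraph of minimum degree at least `c * a`. -/
structure IsDenseSet (G : SimpleGraph V) [DecidableRel G.Adj] (c a : ℕ) (A : Finset V) : Prop where
  nonempty : A.Nonempty
  indep : ∀ I ⊆ A, G.IsIndepSet I → I.card ≤ a
  degree : ∀ v ∈ A, c * a ≤ (A.filter fun w => G.Adj v w).card

/-- A dense set that has no smaller dense subset, with any parameter `a`. -/
structure IsMinDenseSet (G : SimpleGraph V) [DecidableRel G.Adj] (c a : ℕ) (A : Finset V) : Prop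
    extends G.IsDenseSet c a A where
  card_le : ∀ B ⊆ A, ∀ b ≤ a, G.IsDenseSet c b B → A.card ≤ B.card

lemma IsDenseSet.pos {c a : ℕ} {A : Finset V} (hA : G.IsDenseSet c a A) : 1 ≤ a := by
  obtain ⟨v, hv⟩ := hA.nonempty
  simpa using hA.indep {v} (by simpa using hv) (by simp [IsIndepSet])

lemma IsDenseSet.lt_card {c a : ℕ} {A : Finset V} (hA : G.IsDenseSet c a A) : c * a < A.card := by
  obtain ⟨v, hv⟩ := hA.nonempty
  refine (hA.degree v hv).trans_lt (Finset.card_lt_card ?_)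
  exact Finset.filter_ssubset.2 ⟨v, hv, G.irrefl⟩

variable [DecidableEq V]

/-- The size is minimised over all subsets and all parameters at once, which is what lets a
competitor use a smaller parameter. -/
lemma exists_isMinDenseSet (hα : ∀ s : Finset V, G.IsIndepSet s → s.card ≤ k) {c : ℕ}
    {P : Finset V} (hP : c * k * k < P.card) :
    ∃ A ⊆ P, ∃ a ≤ k, G.IsMinDenseSet c a A := by
  have hex : ∃ n, ∃ A ⊆ P, ∃ a ≤ k, G.IsDenseSet c a A ∧ A.card = n := by
    obtain ⟨T, hT, hne, hdeg⟩ := exists_subset_le_degree P (fun I _ hI => hα I hI) hP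
    exact ⟨_, T, hT, k, le_rfl, ⟨hne, fun I _ hI => hα I hI, hdeg⟩, rfl⟩
  classical
  obtain ⟨A, hAP, a, hak, hA, hcard⟩ := Nat.find_spec hex
  refine ⟨A, hAP, a, hak, hA, fun B hB b hb hBd => ?_⟩
  rw [hcard]
  exact Nat.find_min' hex ⟨B, hB.trans hAP, b, hb.trans hak, hBd, rfl⟩

namespace IsMinDenseSet

variable {c a : ℕ} {A : Finset V}

/-- Otherwise `A` minus a vertex would still be large enough to contain a dense set. -/
lemma card_le_succ (hA : G.IsMinDenseSet c a A) : A.card ≤ c * a * a + 1 := by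
  by_contra! hcon
  obtain ⟨v, hv⟩ := hA.nonempty
  have herase := Finset.card_erase_of_mem hv
  obtain ⟨T, hT, hne, hdeg⟩ := exists_subset_le_degree (G := G) (d := c * a) (a := a) (A.erase v)
    (fun I hI hi => hA.indep I (hI.trans (Finset.erase_subset _ _)) hi) (by omega)
  have h1 := hA.card_le T (hT.trans (Finset.erase_subset _ _)) a le_rfl
    ⟨hne, fun I hI hi => hA.indep I (hI.trans (hT.trans (Finset.erase_subset _ _))) hi, hdeg⟩
  have h2 := Finset.card_le_card hT
  omega

/-- Minimal dense sets are highly connected. -/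
lemma lt_card_boundary (hA : G.IsMinDenseSet c a A) {C : Finset V} (hC : C ⊆ A)
    (hne : C.Nonempty) {w : V} (hwA : w ∈ A) (hwC : w ∉ C) (hw : ∀ v ∈ C, ¬ G.Adj v w) :
    c < ((A \ C).filter fun u => ∃ v ∈ C, G.Adj u v).card := by
  by_contra! hcon
  have hlt : C.card < A.card :=
    Finset.card_lt_card ⟨hC, fun h => hwC (h hwA)⟩
  have ha := hA.pos
  -- Adding `w` to independent sets of `C` shows that `C` has parameter `a - 1`. The degree
  -- requirement then drops by `c`, which pays for the neighbours lost to a boundary of at most `c`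
  -- vertices.
  refine absurd (hA.card_le C hC (a - 1) (by omega) ⟨hne, fun I hI hi => ?_, fun v hv => ?_⟩)
    (by omega)
  · have hwI : w ∉ I := fun h => hwC (hI h)
    have := hA.indep (insert w I) (Finset.insert_subset hwA (hI.trans hC)) (by
      rw [Finset.coe_insert]
      exact Set.Pairwise.insert hi fun u hu _ =>
        ⟨fun e => hw u (hI hu) e.symm, hw u (hI hu)⟩)
    rw [Finset.card_insert_of_notMem hwI] at this
    omega
  · have h1 := hA.degree v (hC hv)
    have h2 : (A.filter fun w => G.Adj v w) ⊆ (C.filter fun w => G.Adj v w) ∪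
        ((A \ C).filter fun u => ∃ v ∈ C, G.Adj u v) := by
      intro u hu
      simp only [Finset.mem_filter, Finset.mem_union, Finset.mem_sdiff] at hu ⊢
      by_cases huC : u ∈ C
      · exact Or.inl ⟨huC, hu.2⟩
      · exact Or.inr ⟨⟨hu.1, huC⟩, v, hv, hu.2.symm⟩
    have h3 := (Finset.card_le_card h2).trans (Finset.card_union_le _ _)
    rw [Nat.mul_sub, mul_one]
    omega

lemma exists_isPathList (hA : G.IsMinDenseSet c a A) (hx : x ∈ A) (hy : y ∈ A) :
    ∃ l, G.IsPathList x y l ∧ ∀ v ∈ l, v ∈ A := by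
  classical
  suffices h : Relation.ReflTransGen (G.StepIn A) x y by
    obtain ⟨R, hR, hR'⟩ := exists_isPathList_of_reflTransGen h
    exact ⟨R, hR, fun v hv => mem_of_reflTransGen_stepIn (hR' v hv) hx⟩
  by_contra hcon
  set C := A.filter fun v => Relation.ReflTransGen (G.StepIn A) x v with hC
  have hclosed : ∀ v ∈ C, ∀ u ∈ A, G.Adj v u → u ∈ C := by
    intro v hv u hu e
    rw [hC, Finset.mem_filter] at hv ⊢
    exact ⟨hu, hv.2.tail ⟨e, hv.1, hu⟩⟩
  have hyC : y ∉ C := fun h => hcon (Finset.mem_filter.1 h).2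
  have := hA.lt_card_boundary (C := C) (Finset.filter_subset _ _)
    ⟨x, Finset.mem_filter.2 ⟨hx, .refl⟩⟩ hy hyC fun v hv e => hyC (hclosed v hv y hy e)
  obtain ⟨u, hu⟩ := Finset.card_pos.1 (Nat.zero_lt_of_lt this)
  simp only [Finset.mem_filter, Finset.mem_sdiff] at hu
  obtain ⟨⟨huA, huC⟩, v, hv, e⟩ := hu
  exact huC (hclosed v hv u huA e.symm)

/-- Minimal dense sets are Hamilton-connected. -/
lemma exists_spanning (hα : ∀ s : Finset V, G.IsIndepSet s → s.card ≤ k) (hkc : k ≤ c)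
    (hA : G.IsMinDenseSet c a A) (hx : x ∈ A) (hy : y ∈ A) (hxy : x ≠ y) :
    ∃ l, G.IsPathList x y l ∧ l.toFinset = A := by
  classical
  have hbound : ∀ l, G.IsPathList x y l → (∀ v ∈ l, v ∈ A) → l.length ≤ A.card := by
    intro l hl hlA
    rw [← List.toFinset_card_of_nodup hl.nodup]
    exact Finset.card_le_card fun v hv => hlA v (List.mem_toFinset.1 hv)
  obtain ⟨l, hl, hlA, hmax⟩ : ∃ l, G.IsPathList x y l ∧ (∀ v ∈ l, v ∈ A) ∧
      ∀ l', G.IsPathList x y l' → (∀ v ∈ l', v ∈ A) → l'.length ≤ l.length := by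
    let p : ℕ → Prop := fun n => ∃ l, G.IsPathList x y l ∧ (∀ v ∈ l, v ∈ A) ∧ l.length = n
    obtain ⟨l₀, h₀, h₀A⟩ := hA.exists_isPathList hx hy
    have hp : p (Nat.findGreatest p A.card) :=
      Nat.findGreatest_spec (hbound l₀ h₀ h₀A) ⟨l₀, h₀, h₀A, rfl⟩
    obtain ⟨l, hl, hlA, hn⟩ := hp
    refine ⟨l, hl, hlA, fun l' hl' hlA' => ?_⟩
    rw [hn]
    exact Nat.le_findGreatest (hbound l' hl' hlA') ⟨l', hl', hlA', rfl⟩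
  refine ⟨l, hl, ?_⟩
  by_contra hne
  obtain ⟨z, hzA, hzl⟩ : ∃ z ∈ A, z ∉ l := by
    by_contra! hcon
    exact hne (Finset.Subset.antisymm (fun v hv => hlA v (List.mem_toFinset.1 hv))
      fun v hv => List.mem_toFinset.2 (hcon v hv))
  let S : Set V := {v | v ∈ A ∧ v ∉ l}
  have hzS : z ∈ S := ⟨hzA, hzl⟩
  -- A component of `A` off a longest path. All its neighbours in `A` outside itself lie on the
  -- path.
  set C := A.filter fun v => Relation.ReflTransGen (G.StepIn S) z v with hC
  have hCmem : ∀ v, v ∈ C ↔ Relation.ReflTransGen (G.StepIn S) z v := fun v =>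
    ⟨fun h => (Finset.mem_filter.1 h).2,
      fun h => Finset.mem_filter.2 ⟨(mem_of_reflTransGen_stepIn h hzS).1, h⟩⟩
  have hCS : ∀ v ∈ C, v ∈ S := fun v hv => mem_of_reflTransGen_stepIn ((hCmem v).1 hv) hzS
  have hclosed : ∀ v ∈ C, ∀ u ∈ A, u ∉ l → G.Adj v u → u ∈ C := by
    intro v hv u hu hul e
    exact (hCmem u).2 (((hCmem v).1 hv).tail ⟨e, hCS v hv, hu, hul⟩)
  have hconn : ∀ a ∈ (C : Set V), ∀ b ∈ (C : Set V),
      ∃ R, G.IsPathList a b R ∧ ∀ c ∈ R, c ∈ (C : Set V) := by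
    intro a ha b hb
    have hza := (hCmem a).1 ha
    obtain ⟨R, hR, hR'⟩ := exists_isPathList_of_reflTransGen
      ((reflTransGen_stepIn_symm hza).trans ((hCmem b).1 hb))
    exact ⟨R, hR, fun c hc => (hCmem c).2 (hza.trans (hR' c hc))⟩
  have hlong : ∀ R l' : List V, R ≠ [] → (∀ c ∈ R, c ∈ C) → G.IsPathList x y l' →
      ¬ l'.Perm (R ++ l) := by
    intro R l' hR hRC hl' hp
    have h1 := hmax l' hl' fun v hv => by
      rcases List.mem_append.1 (hp.subset hv) with h | h
      · exact (hCS v (hRC v h)).1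
      · exact hlA v h
    have h2 := hp.length_eq
    have h3 := List.length_pos_of_ne_nil hR
    rw [List.length_append] at h2
    omega
  by_cases hall : ∀ w ∈ l, ∃ v ∈ C, G.Adj w v
  · have h2 : 1 < l.length := by
      by_contra hcon
      have h1 := hl.length_pos
      obtain ⟨u, rfl⟩ := List.length_eq_one_iff.1 (show l.length = 1 by omega)
      have e1 := hl.head
      have e2 := hl.last
      simp at e1 e2
      exact hxy (e1.symm.trans e2)
    obtain ⟨v₀, hv₀, e₀⟩ := hall l[0] (List.getElem_mem _)
    obtain ⟨v₁, hv₁, e₁⟩ := hall l[1] (List.getElem_mem _)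
    obtain ⟨R, hR, hRC⟩ := hconn v₀ hv₀ v₁ hv₁
    obtain ⟨l', hl', hp⟩ := hl.detour (i := 0) h2 hR
      (fun v hv hvl => (hCS v (hRC v hv)).2 hvl) e₀ e₁.symm
    exact hlong R l' hR.ne_nil hRC hl' hp
  · push Not at hall
    obtain ⟨w, hwl, hw⟩ := hall
    have hb := hA.lt_card_boundary (C := C) (Finset.filter_subset _ _)
      ⟨z, (hCmem z).2 .refl⟩ (hlA w hwl) (fun h => (hCS w h).2 hwl)
      fun v hv e => hw v hv e.symm
    obtain ⟨R, l', hne, -, hRC, hl', hp⟩ := hl.extend hα (C := C)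
      (fun v hv => (hCS v hv).2) hconn
      (s := (A \ C).filter fun u => ∃ v ∈ C, G.Adj u v) (by
        intro u hu
        simp only [Finset.mem_filter, Finset.mem_sdiff] at hu
        obtain ⟨⟨huA, huC⟩, v, hv, e⟩ := hu
        refine ⟨?_, v, hv, e⟩
        by_contra hul
        exact huC (hclosed v hv u huA hul e.symm)) (by omega)
    exact hlong R l' hne hRC hl' hp

/-- Two vertices of a minimal dense set are joined by a short path into which many other vertices
of the set can be inserted. -/
lemma exists_flexible (hα : ∀ s : Finset V, G.IsIndepSet s → s.card ≤ k) (hk : 1 ≤ k)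
    (hak : a ≤ k) (hA : G.IsMinDenseSet (12 * k) a A) (hx : x ∈ A) (hy : y ∈ A) (hxy : x ≠ y) :
    ∃ T, G.IsPathList x y T ∧ (∀ v ∈ T, v ∈ A) ∧ T.length ≤ 6 * k * k ∧
      ∃ Z ⊆ A, 2 * k ≤ Z.card ∧ (∀ z ∈ Z, z ∉ T) ∧
        ∀ z ∈ Z, k < (T.toFinset.filter fun v => G.Adj z v).card := by
  obtain ⟨l, hl, hlA⟩ := hA.exists_spanning hα (by omega) hx hy hxy
  have hlen : l.length = A.card := by rw [← hlA, List.toFinset_card_of_nodup hl.nodup]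
  have hlt := hA.lt_card
  have ha := hA.pos
  have hka : k ≤ k * a := Nat.le_mul_of_pos_right k ha
  have hkk : k * a ≤ k * k := Nat.mul_le_mul_left k hak
  rw [mul_assoc] at hlt
  -- The target makes `T` longer than 4ka, as the edge count below needs, yet at most 6k².
  obtain ⟨T, hT, hsub, hT1, hT2⟩ := hl.exists_short hα (t := 4 * (k * a) + 2 * k) (by omega) hk
    (by omega)
  have hTA : ∀ v ∈ T, v ∈ A := fun v hv => by
    rw [← hlA]; exact List.mem_toFinset.2 (hsub.subset hv)
  refine ⟨T, hT, hTA, by rw [mul_assoc]; omega, ?_⟩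
  set τ := T.toFinset with hτ
  have hτc : τ.card = T.length := List.toFinset_card_of_nodup hT.nodup
  have hτA : τ ⊆ A := fun v hv => hTA v (List.mem_toFinset.1 hv)
  set Q := A.filter fun z => k < (τ.filter fun v => G.Adj z v).card with hQ
  -- Double count of the adjacencies between `τ` and `A`: a vertex outside `Q` contributes at most
  -- k, one in `Q` at most `τ.card`.
  have hcount : τ.card * (12 * k * a) ≤ k * A.card + τ.card * Q.card := by
    calc τ.card * (12 * k * a) ≤ ∑ v ∈ τ, (A.filter fun w => G.Adj v w).card := by
          rw [← smul_eq_mul]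
          exact Finset.card_nsmul_le_sum _ _ _ fun v hv => hA.degree v (hτA hv)
      _ = ∑ z ∈ A, (τ.filter fun v => G.Adj z v).card := by
          simp only [Finset.card_filter]
          rw [Finset.sum_comm]
          simp only [G.adj_comm]
      _ ≤ ∑ z ∈ A, (k + if k < (τ.filter fun v => G.Adj z v).card then τ.card else 0) := by
          refine Finset.sum_le_sum fun z _ => ?_
          split_ifs with h
          · exact (Finset.card_filter_le _ _).trans (by omega)
          · omega
      _ = k * A.card + τ.card * Q.card := by
          rw [Finset.sum_add_distrib, ← Finset.sum_filter, Finset.sum_const, Finset.sum_const,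
            smul_eq_mul, smul_eq_mul, mul_comm, mul_comm Q.card]
  have hQc : τ.card + 2 * k ≤ Q.card := by
    by_contra! hcon
    have h1 := hA.card_le_succ
    rw [hτc] at hcon hcount
    generalize T.length = t at *
    generalize Q.card = q at *
    generalize A.card = n at *
    have h2 : k * n ≤ k * (12 * k * a * a + 1) := Nat.mul_le_mul_left _ h1
    have h3 : t * q ≤ t * (8 * (k * a)) := Nat.mul_le_mul_left _ (by omega)
    have h4 : 4 * (k * a) < t := by omega
    have h5 : k ≤ (k * a) * (k * a) := by nlinarith
    have h6 : (4 * (k * a) + 1) * (k * a) ≤ t * (k * a) := Nat.mul_le_mul_right _ h4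
    nlinarith
  refine ⟨Q \ τ, Finset.sdiff_subset.trans (Finset.filter_subset _ _), ?_, ?_, ?_⟩
  · have := Finset.le_card_sdiff τ Q
    omega
  · intro z hz
    exact fun h => (Finset.mem_sdiff.1 hz).2 (List.mem_toFinset.2 h)
  · intro z hz
    exact (Finset.mem_filter.1 (Finset.mem_sdiff.1 hz).1).2

end IsMinDenseSet

omit [DecidableRel G.Adj] in
/-- The complementary arc of a cycle, the cycle being given as a path with adjacent ends. -/
lemma IsPathList.exists_complementary_arc {u w : V} (h : G.IsPathList u w l) (hwu : G.Adj w u)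
    {i j : ℕ} (hij : i < j) (hj : j + 1 < l.length) :
    ∃ a b I, G.IsPathList a b I ∧ G.Adj l[j] a ∧ G.Adj b l[i] ∧
      l.length ≤ I.length + j + 1 ∧ ∀ v ∈ I, l.idxOf v < i ∨ j < l.idxOf v := by
  have hdrop : ∀ v ∈ l.drop (j + 1), j < l.idxOf v := by
    intro v hv
    obtain ⟨m, hm, rfl⟩ := List.getElem_of_mem hv
    rw [List.getElem_drop, h.nodup.idxOf_getElem]
    omega
  obtain rfl | hi := Nat.eq_zero_or_pos i
  · refine ⟨_, _, _, h.drop hj, h.adj_getElem hj, ?_, by simp; omega, fun v hv => Or.inr (hdrop v hv)⟩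
    have := h.head
    rw [List.head?_eq_getElem?, List.getElem?_eq_some_iff] at this
    obtain ⟨_, e⟩ := this
    rwa [e]
  · obtain ⟨i, rfl⟩ := Nat.exists_eq_succ_of_ne_zero hi.ne'
    refine ⟨_, _, _, (h.drop hj).append (h.take (i := i) (by omega)) hwu ?_,
      h.adj_getElem hj, h.adj_getElem (by omega), by simp; omega, ?_⟩
    · exact (List.disjoint_take_drop h.nodup (by omega)).symm
    · intro v hv
      rcases List.mem_append.1 hv with hv | hv
      · exact Or.inr (hdrop v hv)
      · obtain ⟨m, hm, rfl⟩ := List.getElem_of_mem hv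
        rw [List.getElem_take, h.nodup.idxOf_getElem]
        simp at hm
        omega

/-- A Hamilton cycle can be turned into a cycle of any length in the middle range. -/
lemma IsPathList.exists_isCycle_of_length (hα : ∀ s : Finset V, G.IsIndepSet s → s.card ≤ k)
    (hk : 1 ≤ k) {u w : V} (h : G.IsPathList u w l) (hwu : G.Adj w u) {m : ℕ}
    (hm : 8 * k * k ≤ m) (hml : m + 12 * k * k * k + 1 ≤ l.length) :
    ∃ (v : V) (c : G.Walk v v), c.IsCycle ∧ c.length = m := by
  set N := 12 * k * k * k + 1 with hN
  have hkk : k ≤ k * k := Nat.le_mul_of_pos_left k hk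
  rw [mul_assoc] at hm
  obtain ⟨A, hAP, a, hak, hA⟩ := exists_isMinDenseSet hα (c := 12 * k) (P := (l.take N).toFinset)
    (by rw [List.toFinset_card_of_nodup (h.nodup.sublist (List.take_sublist _ _)),
          List.length_take]; omega)
  have hAl : ∀ v ∈ A, v ∈ l ∧ l.idxOf v < N := by
    intro v hv
    obtain ⟨i, hi, rfl⟩ := List.getElem_of_mem (List.mem_toFinset.1 (hAP hv))
    rw [List.getElem_take, h.nodup.idxOf_getElem]
    simp at hi
    exact ⟨List.getElem_mem _, by omega⟩
  -- With extreme positions as ends, the complementary arc misses `A` and so all later insertions.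
  obtain ⟨x, hx, hxmin⟩ := Finset.exists_min_image A (fun v => l.idxOf v) hA.nonempty
  obtain ⟨y, hy, hymax⟩ := Finset.exists_max_image A (fun v => l.idxOf v) hA.nonempty
  have hlt : l.idxOf x < l.idxOf y := by
    have h1 : 1 < A.card := by
      have h2 := hA.lt_card
      have h3 : 0 < 12 * k * a := Nat.mul_pos (by omega) hA.pos
      omega
    obtain ⟨v, hv, hvx⟩ := Finset.exists_mem_ne h1 x
    refine lt_of_lt_of_le (lt_of_le_of_ne (hxmin v hv) fun e => hvx ?_) (hymax v hv)
    exact ((List.idxOf_inj (hAl x hx).1).1 e).symm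
  obtain ⟨b, c, I, hI, hb, hc, hIl, hIA⟩ := h.exists_complementary_arc hwu hlt
    (by have := (hAl y hy).2; omega)
  simp only [List.getElem_idxOf] at hb hc
  obtain ⟨T, hT, hTA, hTl, Z, hZA, hZc, hZT, hZ⟩ := hA.exists_flexible hα hk hak hx hy
    (fun e => by rw [e] at hlt; exact lt_irrefl _ hlt)
  rw [mul_assoc] at hTl
  have hyN := (hAl y hy).2
  obtain ⟨J, hJ, hJI, hJ1, hJ2⟩ := hI.exists_short hα (t := m - T.length) (by omega) hk (by omega)
  -- The arc falls short of the target by less than 2k, which the reservoir `Z` covers.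
  obtain ⟨Y, hYZ, hY⟩ := Finset.exists_subset_card_eq (s := Z) (n := m - T.length - J.length)
    (by omega)
  obtain ⟨T', hT', hTs, hTl'⟩ := hT.insert_many hα Y (fun z hz => hZT z (hYZ hz))
    (fun z hz => hZ z (hYZ hz))
  have hcyc := hT'.append hJ hb (by
    intro v hv hvJ
    have hvA : v ∈ A := by
      have : v ∈ T.toFinset ∪ Y := hTs ▸ List.mem_toFinset.2 hv
      rcases Finset.mem_union.1 this with h | h
      · exact hTA v (List.mem_toFinset.1 h)
      · exact hZA (hYZ h)
    have h1 := hxmin v hvA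
    have h2 := hymax v hvA
    rcases hIA v (hJI.subset hvJ) with h3 | h3 <;> omega)
  have hlen : (T' ++ J).length = m := by
    rw [List.length_append, hTl', hY]
    omega
  obtain ⟨v, c, hc1, hc2⟩ := hcyc.exists_isCycle hc (by rw [hlen]; omega)
  exact ⟨v, c, hc1, hc2.trans hlen⟩

end SimpleGraph

/-! ### Short cycles: monotone paths, trees and expansion. -/

namespace SimpleGraph

variable {V : Type*} {G : SimpleGraph V} {k : ℕ}

/-- Either `N` contains a path of `m + 1` vertices along which `r` increases, or it contains an
independent set of at least `|N| / m` vertices. -/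
lemma exists_monotone_path_or_isIndepSet {r : V → ℕ} (hr : r.Injective)
    (m : ℕ) (N : Finset V) :
    (∃ p : List V, p.length = m + 1 ∧ (∀ v ∈ p, v ∈ N) ∧
      p.IsChain fun u v => G.Adj u v ∧ r u < r v) ∨
    ∃ I ⊆ N, G.IsIndepSet I ∧ N.card ≤ m * I.card := by
  classical
  induction m generalizing N with
  | zero =>
    rcases N.eq_empty_or_nonempty with rfl | ⟨v, hv⟩
    · exact Or.inr ⟨∅, by simp, by simp [IsIndepSet], by simp⟩
    · exact Or.inl ⟨[v], by simp, by simpa using hv, by simp⟩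
  | succ m ih =>
    -- Vertices without a lower neighbour are independent; a path starting outside `I` extends
    -- downwards.
    set I := N.filter fun u => ¬ ∃ w ∈ N, G.Adj w u ∧ r w < r u with hI
    have hind : G.IsIndepSet I := by
      intro u hu w hw huw e
      have hu' := Finset.mem_filter.1 hu
      have hw' := Finset.mem_filter.1 hw
      rcases lt_or_gt_of_ne (fun e => huw (hr e) : r u ≠ r w) with h | h
      · exact hw'.2 ⟨u, hu'.1, e, h⟩
      · exact hu'.2 ⟨w, hw'.1, e.symm, h⟩
    have hIN : I ⊆ N := Finset.filter_subset _ _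
    have hc := Finset.card_sdiff_add_card_eq_card hIN
    rcases ih (N \ I) with ⟨p, hp, hpN, hch⟩ | ⟨J, hJ, hJi, hJc⟩
    · cases p with
      | nil => simp at hp
      | cons u p =>
        have hu := Finset.mem_sdiff.1 (hpN u (by simp))
        obtain ⟨w, hw, e⟩ : ∃ w ∈ N, G.Adj w u ∧ r w < r u := by
          by_contra hcon
          exact hu.2 (Finset.mem_filter.2 ⟨hu.1, hcon⟩)
        refine Or.inl ⟨w :: u :: p, by simpa using hp, ?_, List.isChain_cons_cons.2 ⟨e, hch⟩⟩
        intro v hv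
        rcases List.mem_cons.1 hv with rfl | hv
        · exact hw
        · exact (Finset.mem_sdiff.1 (hpN v hv)).1
    · right
      rcases le_total I.card J.card with h | h
      · exact ⟨J, hJ.trans Finset.sdiff_subset, hJi, by linarith⟩
      · exact ⟨I, hIN, hind, by nlinarith [Nat.mul_le_mul_left m h]⟩

/-- A ranking of the vertices compatible with the parent function `π`: vertices are compared
first by the ranks of their ancestors. -/
def treeRank (π : V → V) (M : ℕ) (e : V → ℕ) : ℕ → V → ℕ
  | 0, u => e u
  | i + 1, u => M * treeRank π M e i (π u) + e u

section TreeRank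

variable {π : V → V} {M : ℕ} {e : V → ℕ}

lemma treeRank_injective (he : e.Injective) (hM : ∀ u, e u < M) (i : ℕ) :
    (treeRank π M e i).Injective := by
  cases i with
  | zero => exact he
  | succ i =>
    intro u w h
    have h' := congrArg (· % M) h
    simp only [treeRank, Nat.mul_add_mod, Nat.mod_eq_of_lt (hM _)] at h'
    exact he h'

/-- The rank is a base-`M` numeral with the vertex itself as last digit; dividing by `M` passes to
the parent. Hence the descendants of one vertex in a level occupy an interval of the ranking. -/
lemma treeRank_iterate_le (hM : ∀ u, e u < M) {i s : ℕ} {u w : V}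
    (h : treeRank π M e (i + s) u ≤ treeRank π M e (i + s) w) :
    treeRank π M e i (π^[s] u) ≤ treeRank π M e i (π^[s] w) := by
  induction s generalizing u w with
  | zero => exact h
  | succ s ih =>
    simp only [Function.iterate_succ_apply]
    apply ih
    have hpos : 0 < M := (Nat.zero_le _).trans_lt (hM u)
    rw [← add_assoc] at h
    have h' := Nat.div_le_div_right (c := M) h
    simpa only [treeRank, Nat.mul_add_div hpos, Nat.div_eq_of_lt (hM _),
      add_zero] using h'

end TreeRank

/-- Pairwise disjoint levels of a rooted tree in `G` with parent function `π`. -/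
structure IsTreeLevels (G : SimpleGraph V) (π : V → V) (N : ℕ → Finset V) : Prop where
  disj : ∀ i j u, u ∈ N i → u ∈ N j → i = j
  parent : ∀ i, ∀ u ∈ N (i + 1), π u ∈ N i ∧ G.Adj u (π u)
  root : ∀ u ∈ N 0, ∀ w ∈ N 0, u = w

namespace IsTreeLevels

variable {π : V → V} {N : ℕ → Finset V}

lemma iterate_mem (h : G.IsTreeLevels π N) {i s : ℕ} {u : V} (hu : u ∈ N (i + s)) :
    π^[s] u ∈ N i := by
  induction s generalizing u with
  | zero => exact hu
  | succ s ih => exact ih (h.parent _ u hu).1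

lemma eq_of_iterate_eq (h : G.IsTreeLevels π N) {i s t : ℕ} {u w : V} (hu : u ∈ N i) (hw : w ∈ N i)
    (hs : s ≤ i) (ht : t ≤ i) (e : π^[s] u = π^[t] w) : s = t := by
  have h1 := h.iterate_mem (i := i - s) (s := s) (u := u) (by rwa [Nat.sub_add_cancel hs])
  have h2 := h.iterate_mem (i := i - t) (s := t) (u := w) (by rwa [Nat.sub_add_cancel ht])
  rw [e] at h1
  have := h.disj _ _ _ h1 h2
  omega

lemma isPathList_iterate (h : G.IsTreeLevels π N) {i s : ℕ} {u : V} (hu : u ∈ N i) (hs : s ≤ i) :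
    G.IsPathList u (π^[s] u) ((List.range (s + 1)).map fun j => π^[j] u) := by
  induction s with
  | zero => exact .singleton u
  | succ s ih =>
    rw [List.range_succ, List.map_append]
    refine (ih (by omega)).append (.singleton _) ?_ ?_
    · rw [Function.iterate_succ_apply']
      exact (h.parent (i - (s + 1)) _ (h.iterate_mem (by
        rwa [show i - (s + 1) + 1 + s = i by omega]))).2
    · intro v hv hv'
      simp only [List.mem_map, List.mem_range] at hv
      obtain ⟨j, hj, rfl⟩ := hv
      have := h.eq_of_iterate_eq hu hu (by omega) hs (List.mem_singleton.1 hv')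
      omega

/-- A long monotone path inside one of the first levels closes up to a cycle of prescribed length
through the tree. -/
lemma exists_isCycle (h : G.IsTreeLevels π N) {M : ℕ} {e : V → ℕ} (he : e.Injective)
    (hM : ∀ u, e u < M) {i n : ℕ} (hi : 2 * i < n) (hn : 3 ≤ n) {p : List V}
    (hp : p.length + 1 = n) (hpN : ∀ v ∈ p, v ∈ N i)
    (hch : p.IsChain fun u v => G.Adj u v ∧ treeRank π M e i u < treeRank π M e i v) :
    ∃ (v : V) (c : G.Walk v v), c.IsCycle ∧ c.length = n := by
  classical
  have hinj := fun j => treeRank_injective (π := π) he hM j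
  have hpw : p.Pairwise fun u v => treeRank π M e i u < treeRank π M e i v := by
    have := hch.imp (S := fun u v => treeRank π M e i u < treeRank π M e i v) fun _ _ h => h.2
    have htrans : IsTrans V fun u v => treeRank π M e i u < treeRank π M e i v :=
      ⟨fun _ _ _ => lt_trans⟩
    exact List.isChain_iff_pairwise.1 this
  have hnd : p.Nodup := hpw.imp fun h e => by rw [e] at h; exact lt_irrefl _ h
  have hmono : ∀ a b (ha : a < p.length) (hb : b < p.length), a ≤ b →
      treeRank π M e i p[a] ≤ treeRank π M e i p[b] := by
    intro a b ha hb hab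
    rcases hab.eq_or_lt with rfl | hab
    · exact le_rfl
    · exact (List.pairwise_iff_getElem.1 hpw a b ha hb hab).le
  have hex : ∃ t, ∀ u ∈ p, ∀ w ∈ p, π^[t] u = π^[t] w :=
    ⟨i, fun u hu w hw => h.root _ (h.iterate_mem (by simpa using hpN u hu)) _
      (h.iterate_mem (by simpa using hpN w hw))⟩
  have hti : Nat.find hex ≤ i := Nat.find_min' hex
    fun u hu w hw => h.root _ (h.iterate_mem (by simpa using hpN u hu)) _
      (h.iterate_mem (by simpa using hpN w hw))
  have hspec := Nat.find_spec hex
  obtain ⟨t, ht⟩ : ∃ t, Nat.find hex = t + 1 := by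
    refine Nat.exists_eq_succ_of_ne_zero fun h0 => ?_
    rw [h0] at hspec
    have := hspec p[0] (List.getElem_mem (by omega)) p[1] (List.getElem_mem (by omega))
    simp only [Function.iterate_zero, id_eq] at this
    rw [hnd.getElem_inj_iff] at this
    omega
  have hmin := Nat.find_min hex (m := t) (by omega)
  rw [ht] at hspec hti
  -- The whole path first shares an ancestor `t + 1` generations up, so `t` generations up the
  -- ancestor changes somewhere.
  obtain ⟨j, hj, hjne⟩ : ∃ j, ∃ hj : j + 1 < p.length, π^[t] p[j] ≠ π^[t] p[j + 1] := by
    by_contra! hcon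
    apply hmin
    have hall : ∀ j (hj : j < p.length), π^[t] p[j] = π^[t] p[0] := by
      intro j
      induction j with
      | zero => intro _; rfl
      | succ j ih => intro hj; rw [← hcon j hj]; exact ih (by omega)
    intro u hu w hw
    obtain ⟨a, ha, rfl⟩ := List.getElem_of_mem hu
    obtain ⟨b, hb, rfl⟩ := List.getElem_of_mem hw
    rw [hall a ha, hall b hb]
  -- A window around the change whose `b - a` path edges and two branches of `t + 1` edges total
  -- `n`. By monotonicity the branches stay apart below the common ancestor.
  obtain ⟨a, b, haj, hjb, hb, hab⟩ :
      ∃ a b, a ≤ j ∧ j + 1 ≤ b ∧ b < p.length ∧ b + 2 * (t + 1) = a + n := by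
    rcases le_total j (2 * t) with h | h
    · exact ⟨j, j + n - 2 * (t + 1), by omega, by omega, by omega, by omega⟩
    · exact ⟨2 * t, n - 2, by omega, by omega, by omega, by omega⟩
  have hne : π^[t] p[a] ≠ π^[t] p[b] := by
    intro heq
    have key : ∀ c d (hc : c < p.length) (hd : d < p.length), c ≤ d →
        treeRank π M e (i - t) (π^[t] p[c]) ≤ treeRank π M e (i - t) (π^[t] p[d]) := by
      intro c d hc hd hcd
      apply treeRank_iterate_le hM
      rw [Nat.sub_add_cancel (by omega)]
      exact hmono c d hc hd hcd
    have h1 := key a j (by omega) (by omega) haj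
    have h2 := key j (j + 1) (by omega) (by omega) (by omega)
    have h3 := key (j + 1) b (by omega) (by omega) hjb
    rw [← heq] at h3
    exact hjne (hinj (i - t) (by omega))
  have hpa : p[a] ∈ N i := hpN _ (List.getElem_mem _)
  have hpb : p[b] ∈ N i := hpN _ (List.getElem_mem _)
  have hparent : π p[b] ∈ N (i - 1) ∧ G.Adj p[b] (π p[b]) :=
    h.parent (i - 1) _ (by rwa [Nat.sub_add_cancel (by omega)])
  have hpath : G.IsPathList (p[0]'(by omega)) (p[p.length - 1]'(by omega)) p :=
    ⟨hnd, hch.imp fun _ _ h => h.1,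
      by rw [List.head?_eq_getElem?, List.getElem?_eq_getElem],
      by rw [List.getLast?_eq_getElem?, List.getElem?_eq_getElem]⟩
  have hX := (h.isPathList_iterate hpa (s := t) (by omega)).reverse
  have hY : G.IsPathList p[a + 1] p[b] ((p.take (b + 1)).drop (a + 1)) := by
    have := (hpath.take hb).drop (i := a + 1) (by simp; omega)
    simpa using this
  have hZ := h.isPathList_iterate hparent.1 (s := t) (by omega)
  have hYmem : ∀ v ∈ (p.take (b + 1)).drop (a + 1), ∃ c, ∃ hc : c < p.length, a < c ∧ p[c] = v := by
    intro v hv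
    obtain ⟨c, hc, rfl⟩ := List.getElem_of_mem hv
    simp only [List.length_drop, List.length_take] at hc
    exact ⟨a + 1 + c, by omega, by omega, by simp⟩
  have hcyc := (hX.append (hY.append hZ hparent.2 ?_) (hpath.adj_getElem (by omega)) ?_)
  · have hclose : G.Adj (π^[t] (π p[b])) (π^[t] p[a]) := by
      rw [← Function.iterate_succ_apply, ← hspec p[a] (List.getElem_mem _) p[b] (List.getElem_mem _),
        Function.iterate_succ_apply']
      exact (h.parent (i - (t + 1)) _ (h.iterate_mem (by
        rwa [show i - (t + 1) + 1 + t = i by omega]))).2.symm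
    have hlen : (((List.range (t + 1)).map fun j => π^[j] p[a]).reverse ++
        ((p.take (b + 1)).drop (a + 1) ++
          (List.range (t + 1)).map fun j => π^[j] (π p[b]))).length = n := by
      simp; omega
    obtain ⟨v, c, hc1, hc2⟩ := hcyc.exists_isCycle hclose (by rw [hlen]; exact hn)
    exact ⟨v, c, hc1, hc2.trans hlen⟩
  · intro v hv hv'
    obtain ⟨c, hc, hac, rfl⟩ := hYmem v hv
    simp only [List.mem_map, List.mem_range] at hv'
    obtain ⟨q, hq, e⟩ := hv'
    rw [← Function.iterate_succ_apply] at e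
    have := h.eq_of_iterate_eq (s := q + 1) (t := 0) hpb (hpN _ (List.getElem_mem hc)) (by omega)
      (by omega) e
    omega
  · intro v hv hv'
    simp only [List.mem_reverse, List.mem_map, List.mem_range] at hv
    obtain ⟨q, hq, rfl⟩ := hv
    rcases List.mem_append.1 hv' with hv' | hv'
    · obtain ⟨c, hc, hac, e⟩ := hYmem _ hv'
      have := h.eq_of_iterate_eq (s := 0) (t := q) (hpN _ (List.getElem_mem hc)) hpa (by omega)
        (by omega) e
      subst this
      simp only [Function.iterate_zero, id_eq] at e
      rw [hnd.getElem_inj_iff] at e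
      omega
    · simp only [List.mem_map, List.mem_range] at hv'
      obtain ⟨q', hq', e⟩ := hv'
      rw [← Function.iterate_succ_apply] at e
      have := h.eq_of_iterate_eq (s := q' + 1) (t := q) hpb hpa (by omega) (by omega) e
      subst this
      apply hne
      have := congrArg (π^[t - (q' + 1)]) e
      rw [← Function.iterate_add_apply, ← Function.iterate_add_apply,
        Nat.sub_add_cancel (by omega)] at this
      exact this.symm

end IsTreeLevels

section Levels

variable [DecidableEq V] [DecidableRel G.Adj]

/-- The vertices of `S` at distance at most `i` from `v` inside `S`. -/
def ballIn (G : SimpleGraph V) [DecidableRel G.Adj] (S : Finset V) (v : V) : ℕ → Finset V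
  | 0 => {v}
  | i + 1 => ballIn G S v i ∪ S.filter fun w => ∃ u ∈ ballIn G S v i, G.Adj u w

/-- The vertices of `S` at distance exactly `i` from `v` inside `S`. -/
def levelIn (G : SimpleGraph V) [DecidableRel G.Adj] (S : Finset V) (v : V) : ℕ → Finset V
  | 0 => {v}
  | i + 1 => G.ballIn S v (i + 1) \ G.ballIn S v i

variable {S : Finset V} {v : V}

lemma ballIn_subset_succ (i : ℕ) : G.ballIn S v i ⊆ G.ballIn S v (i + 1) :=
  Finset.subset_union_left

lemma ballIn_mono : Monotone (G.ballIn S v) :=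
  monotone_nat_of_le_succ fun i => ballIn_subset_succ i

lemma mem_ballIn_succ {i : ℕ} {u w : V} (hu : u ∈ G.ballIn S v i) (hw : w ∈ S)
    (e : G.Adj u w) : w ∈ G.ballIn S v (i + 1) :=
  Finset.mem_union_right _ (Finset.mem_filter.2 ⟨hw, u, hu, e⟩)

lemma levelIn_subset_ballIn (i : ℕ) : G.levelIn S v i ⊆ G.ballIn S v i := by
  cases i with
  | zero => exact subset_rfl
  | succ i => exact Finset.sdiff_subset

lemma notMem_ballIn_of_mem_levelIn {i j : ℕ} (hij : i < j) {u : V} (hu : u ∈ G.levelIn S v j) :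
    u ∉ G.ballIn S v i := by
  obtain ⟨j, rfl⟩ := Nat.exists_eq_succ_of_ne_zero (by omega : j ≠ 0)
  exact fun h => (Finset.mem_sdiff.1 hu).2 (ballIn_mono (by omega : i ≤ j) h)

lemma levelIn_subset (hv : v ∈ S) (i : ℕ) : G.levelIn S v i ⊆ S := by
  refine (levelIn_subset_ballIn i).trans ?_
  induction i with
  | zero => simpa [ballIn] using hv
  | succ i ih => exact Finset.union_subset ih (Finset.filter_subset _ _)

lemma mem_ballIn_cases {i : ℕ} {u : V} (hu : u ∈ G.ballIn S v i) :
    u ∈ G.levelIn S v i ∨ ∃ j, i = j + 1 ∧ u ∈ G.ballIn S v j := by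
  cases i with
  | zero => exact Or.inl hu
  | succ i =>
    by_cases h : u ∈ G.ballIn S v i
    · exact Or.inr ⟨i, rfl, h⟩
    · exact Or.inl (Finset.mem_sdiff.2 ⟨hu, h⟩)

lemma exists_parent (hv : v ∈ S) {i : ℕ} {u : V} (hu : u ∈ G.levelIn S v (i + 1)) :
    ∃ w ∈ G.levelIn S v i, G.Adj u w := by
  obtain ⟨h1, h2⟩ := Finset.mem_sdiff.1 hu
  obtain ⟨-, w, hw, e⟩ := Finset.mem_filter.1 ((Finset.mem_union.1 h1).resolve_left h2)
  rcases mem_ballIn_cases hw with h | ⟨j, rfl, hj⟩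
  · exact ⟨w, h, e.symm⟩
  · exact absurd (mem_ballIn_succ hj (levelIn_subset hv _ hu) e) h2

/-- Disjointness of the levels lets one parent map serve all of them. -/
lemma exists_isTreeLevels (hv : v ∈ S) : ∃ π, G.IsTreeLevels π (G.levelIn S v) := by
  have hdisj : ∀ i j u, u ∈ G.levelIn S v i → u ∈ G.levelIn S v j → i = j := by
    intro i j u hi hj
    rcases lt_trichotomy i j with h | h | h
    · exact absurd (levelIn_subset_ballIn i hi) (notMem_ballIn_of_mem_levelIn h hj)
    · exact h
    · exact absurd (levelIn_subset_ballIn j hj) (notMem_ballIn_of_mem_levelIn h hi)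
  have hex : ∀ u, ∃ w, ∀ i, u ∈ G.levelIn S v (i + 1) → w ∈ G.levelIn S v i ∧ G.Adj u w := by
    intro u
    by_cases h : ∃ i, u ∈ G.levelIn S v (i + 1)
    · obtain ⟨i, hi⟩ := h
      obtain ⟨w, hw, e⟩ := exists_parent hv hi
      refine ⟨w, fun j hj => ?_⟩
      obtain rfl : i = j := by have := hdisj _ _ _ hi hj; omega
      exact ⟨hw, e⟩
    · exact ⟨u, fun i hi => absurd ⟨i, hi⟩ h⟩
  choose π hπ using hex
  refine ⟨π, hdisj, fun i u hu => hπ u i hu, ?_⟩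
  intro u hu w hw
  simp only [levelIn, Finset.mem_singleton] at hu hw
  rw [hu, hw]

/-- The closed neighbourhood of `I` in `S`. -/
def closedNbhdIn (G : SimpleGraph V) [DecidableRel G.Adj] (S I : Finset V) : Finset V :=
  S.filter fun w => w ∈ I ∨ ∃ u ∈ I, G.Adj u w

lemma closedNbhdIn_root : G.closedNbhdIn S {v} ⊆ G.levelIn S v 0 ∪ G.levelIn S v 1 := by
  intro w hw
  simp only [closedNbhdIn, Finset.mem_filter, Finset.mem_singleton, exists_eq_left] at hw
  by_cases h : w = v
  · exact Finset.mem_union_left _ (by simp [levelIn, h])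
  · refine Finset.mem_union_right _ (Finset.mem_sdiff.2 ⟨?_, by simpa [ballIn] using h⟩)
    exact mem_ballIn_succ (u := v) (by simp [ballIn]) hw.1 (by tauto)

lemma closedNbhdIn_level (hv : v ∈ S) {i : ℕ} {I : Finset V} (hI : I ⊆ G.levelIn S v (i + 1)) :
    G.closedNbhdIn S I ⊆
      G.levelIn S v i ∪ G.levelIn S v (i + 1) ∪ G.levelIn S v (i + 2) := by
  intro w hw
  simp only [closedNbhdIn, Finset.mem_filter] at hw
  simp only [Finset.mem_union]
  obtain ⟨hwS, hw | ⟨u, hu, e⟩⟩ := hw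
  · exact Or.inl (Or.inr (hI hw))
  have hu' := hI hu
  have hw2 : w ∈ G.ballIn S v (i + 2) := mem_ballIn_succ (levelIn_subset_ballIn _ hu') hwS e
  rcases mem_ballIn_cases hw2 with h2 | ⟨j, hj, h2⟩
  · exact Or.inr h2
  obtain rfl : i + 1 = j := by omega
  rcases mem_ballIn_cases h2 with h1 | ⟨j, hj, h1⟩
  · exact Or.inl (Or.inr h1)
  obtain rfl : i = j := by omega
  rcases mem_ballIn_cases h1 with h0 | ⟨j, rfl, h0⟩
  · exact Or.inl (Or.inl h0)
  · exact absurd (mem_ballIn_succ h0 (levelIn_subset hv _ hu') e.symm)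
      (notMem_ballIn_of_mem_levelIn (by omega) hu')

/-- A graph in which independent sets expand well contains a cycle of length `n`. -/
lemma exists_isCycle_of_expanding [Finite V] {n β x : ℕ} (hn : 3 ≤ n) (hβ : 1 ≤ β)
    (hx : 2 * x < n) (hx1 : 1 ≤ x) (hβx : k ≤ β ^ x) (hS : S.Nonempty)
    (hα : ∀ I ⊆ S, G.IsIndepSet I → I.card ≤ k)
    (hexp : ∀ I ⊆ S, I.Nonempty → G.IsIndepSet I →
      (n - 2) * (β + 2) * I.card < (G.closedNbhdIn S I).card) :
    ∃ (v : V) (c : G.Walk v v), c.IsCycle ∧ c.length = n := by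
  by_contra hcon
  obtain ⟨v, hv⟩ := hS
  obtain ⟨π, hπ⟩ := exists_isTreeLevels (G := G) hv
  obtain ⟨M, ⟨f⟩⟩ := Finite.exists_equiv_fin V
  obtain ⟨m, rfl⟩ := Nat.exists_eq_add_of_le' (show 2 ≤ n by omega)
  simp only [Nat.add_sub_cancel] at hexp
  have hind : ∀ i ≤ x, ∃ I ⊆ G.levelIn S v i, G.IsIndepSet I ∧
      (G.levelIn S v i).card ≤ m * I.card := by
    intro i hi
    have he : Function.Injective fun u => (f u : ℕ) := Fin.val_injective.comp f.injective
    have hM : ∀ u, (f u : ℕ) < M := fun u => (f u).2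
    rcases exists_monotone_path_or_isIndepSet (G := G) (treeRank_injective (π := π) he hM i) m
      (G.levelIn S v i) with ⟨p, hp, hpN, hch⟩ | h
    · exact absurd (hπ.exists_isCycle he hM (by omega) hn (by omega) hpN hch) hcon
    · exact h
  have hgrow : ∀ i, i + 1 ≤ x → β ^ i * (m * (β + 2)) ≤ (G.levelIn S v (i + 1)).card ∧
      (G.levelIn S v i).card ≤ (G.levelIn S v (i + 1)).card := by
    intro i
    induction i with
    | zero =>
      intro _
      have h1 := hexp {v} (by simpa using hv) (by simp) (by simp [IsIndepSet])
      have h2 := (Finset.card_le_card (closedNbhdIn_root (G := G) (S := S) (v := v))).trans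
        (Finset.card_union_le _ _)
      have h3 : (G.levelIn S v 0).card = 1 := by simp [levelIn]
      have h4 : 1 ≤ m * (β + 2) := Nat.mul_pos (by omega) (by omega)
      simp only [Finset.card_singleton, mul_one, pow_zero, one_mul, zero_add] at *
      omega
    | succ i ih =>
      intro hix
      obtain ⟨h1, h2⟩ := ih (by omega)
      obtain ⟨I, hI, hIi, hIc⟩ := hind (i + 1) (by omega)
      have hpos : 0 < (G.levelIn S v (i + 1)).card :=
        lt_of_lt_of_le (Nat.mul_pos (pow_pos (by omega) _) (Nat.mul_pos (by omega) (by omega))) h1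
      have hIne : I.Nonempty := by
        rw [Finset.nonempty_iff_ne_empty]
        rintro rfl
        simp at hIc
        simp [hIc] at hpos
      have h3 := hexp I (hI.trans (levelIn_subset hv _)) hIne hIi
      have h4 := (Finset.card_le_card (closedNbhdIn_level (G := G) hv hI)).trans
        (Finset.card_union_le _ _)
      have h5 := Finset.card_union_le (G.levelIn S v i) (G.levelIn S v (i + 1))
      have h6 : (β + 2) * (G.levelIn S v (i + 1)).card ≤ (β + 2) * (m * I.card) :=
        Nat.mul_le_mul_left _ hIc
      have h7 : m * (β + 2) * I.card = (β + 2) * (m * I.card) := by ring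
      -- The neighbourhood of `I` exceeds β+2 times the current level, and the two lower levels take
      -- at most two of these shares.
      have h8 : β * (G.levelIn S v (i + 1)).card ≤ (G.levelIn S v (i + 2)).card := by
        rw [add_mul] at h6
        omega
      refine ⟨?_, (Nat.le_mul_of_pos_left _ hβ).trans h8⟩
      refine le_trans ?_ h8
      rw [pow_succ', mul_assoc]
      exact Nat.mul_le_mul_left _ h1
  obtain ⟨x, rfl⟩ := Nat.exists_eq_add_of_le' hx1
  obtain ⟨h1, -⟩ := hgrow x le_rfl
  obtain ⟨I, hI, hIi, hIc⟩ := hind (x + 1) le_rfl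
  have h2 := Nat.mul_le_mul_left m ((hα I (hI.trans (levelIn_subset hv _)) hIi).trans hβx)
  have h3 : 0 < β ^ x * m := Nat.mul_pos (pow_pos (by omega) _) (by omega)
  rw [pow_succ] at h2
  nlinarith

/-- The Ramsey-type bound of Erdős, Faudree, Rousseau and Schelp: a large vertex set contains a
cycle of length `n` or an independent set of more than `k` vertices. -/
lemma exists_isCycle_of_card_lt [Finite V] {n β x a : ℕ} (hn : 3 ≤ n) (hβ : 1 ≤ β)
    (hx : 2 * x < n) (hx1 : 1 ≤ x) (hβx : k ≤ β ^ x) (hak : a ≤ k) (S : Finset V)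
    (hα : ∀ I ⊆ S, G.IsIndepSet I → I.card ≤ a) (hS : (n - 2) * (β + 2) * a < S.card) :
    ∃ (v : V) (c : G.Walk v v), c.IsCycle ∧ c.length = n := by
  induction a using Nat.strong_induction_on generalizing S with
  | _ a ih =>
    by_cases hexp : ∀ I ⊆ S, I.Nonempty → G.IsIndepSet I →
      (n - 2) * (β + 2) * I.card < (G.closedNbhdIn S I).card
    · exact exists_isCycle_of_expanding hn hβ hx hx1 hβx
        (Finset.card_pos.1 (by omega)) (fun I hI hi => (hα I hI hi).trans hak) hexp
    push Not at hexp
    obtain ⟨I, hI, hne, hi, hc⟩ := hexp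
    have hIa := hα I hI hi
    have hIpos := Finset.card_pos.2 hne
    -- Removing a non-expanding `I` with its neighbourhood lowers the independence bound by `I.card`
    -- and the size at most proportionally.
    refine ih (a - I.card) (by omega) (by omega) (S \ G.closedNbhdIn S I) ?_ ?_
    · intro J hJ hJi
      have hnot : ∀ w ∈ J, w ∉ I ∧ ∀ u ∈ I, ¬ G.Adj u w := by
        intro w hw
        obtain ⟨hwS, hwN⟩ := Finset.mem_sdiff.1 (hJ hw)
        simpa only [closedNbhdIn, Finset.mem_filter, hwS, true_and, not_or, not_exists,
          not_and] using hwN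
      have hdisj : Disjoint I J := Finset.disjoint_left.2 fun w hwI hwJ => (hnot w hwJ).1 hwI
      have := hα (I ∪ J) (Finset.union_subset hI (hJ.trans Finset.sdiff_subset)) (by
        rw [Finset.coe_union]
        exact Set.pairwise_union.2 ⟨hi, hJi, fun u hu w hw _ =>
          ⟨(hnot w hw).2 u hu, fun e => (hnot w hw).2 u hu e.symm⟩⟩)
      rw [Finset.card_union_of_disjoint hdisj] at this
      omega
    · have h1 := Finset.card_sdiff_add_card_eq_card
        (show G.closedNbhdIn S I ⊆ S from Finset.filter_subset _ _)
      rw [Nat.mul_sub]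
      have h2 := Nat.mul_le_mul_left ((n - 2) * (β + 2)) hIa
      omega

end Levels

/-! ### Assembling the three ranges. -/

/-- A Hamiltonian graph with at least two vertices has a path through all vertices with adjacent
ends. -/
lemma IsHamiltonian.exists_isPathList [Fintype V] [DecidableEq V] (hG : G.IsHamiltonian)
    (h1 : Fintype.card V ≠ 1) :
    ∃ x y l, G.IsPathList x y l ∧ G.Adj y x ∧ l.length = Fintype.card V := by
  obtain ⟨a, p, hp⟩ := hG h1
  have hcyc := hp.isCycle
  cases p with
  | nil => exact absurd hcyc (by simp)
  | @cons _ b _ e q =>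
    have hq := (Walk.cons_isCycle_iff q e).1 hcyc
    refine ⟨b, a, q.support, ⟨hq.1.support_nodup, q.isChain_adj_support, ?_, ?_⟩, e, ?_⟩
    · rw [List.head?_eq_some_head q.support_ne_nil, Walk.head_support]
    · rw [List.getLast?_eq_some_getLast q.support_ne_nil, Walk.getLast_support]
    · rw [Walk.length_support, ← hp.length_eq, Walk.length_cons]

end SimpleGraph

theorem theorem1p2 {V : Type*} [Fintype V] [DecidableEq V] (G : SimpleGraph V)
    (hG : G.IsHamiltonian) (hn : 150 * G.indepNum ^ 3 ≤ Fintype.card V) :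
    G.IsPancyclic := by
  classical
  intro n hn3 hnV
  obtain ⟨x, y, l, hl, hyx, hlV⟩ := hG.exists_isPathList (by omega)
  set k := G.indepNum with hk
  have hα : ∀ s : Finset V, G.IsIndepSet s → s.card ≤ k := fun s hs => hs.card_le_indepNum
  have hk1 : 1 ≤ k := by
    simpa using hα {x} (by simp [SimpleGraph.IsIndepSet])
  have hk2 : k ≤ k * k := Nat.le_mul_of_pos_left k hk1
  have hk3 : k * k ≤ k * k * k := Nat.le_mul_of_pos_right _ hk1
  rw [pow_succ, pow_two] at hn
  by_cases hlarge : (2 * k + 1) * (3 * k * k + 1) ≤ n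
  · obtain ⟨l', hl', hlen⟩ := hl.exists_length_eq hα hk1 hlarge (by omega)
    rw [← hlen]
    exact hl'.exists_isCycle hyx (by omega)
  have hle : n ≤ 12 * (k * k * k) := by
    have : (2 * k + 1) * (3 * k * k + 1) = 6 * (k * k * k) + 3 * (k * k) + 2 * k + 1 := by ring
    omega
  by_cases hmid : 8 * k * k ≤ n
  · refine hl.exists_isCycle_of_length hα hk1 hyx hmid ?_
    have : 12 * k * k * k = 12 * (k * k * k) := by ring
    omega
  rw [mul_assoc] at hmid
  have hu : (Finset.univ : Finset V).card = Fintype.card V := Finset.card_univ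
  obtain ⟨m, rfl⟩ := Nat.exists_eq_add_of_le' (show 2 ≤ n by omega)
  -- The Ramsey bound needs `k ≤ β ^ x` with `2 * x < n`: one level with β = k for small n,
  -- otherwise k levels with β = 2. The costs are at most 6k³ and 32k³.
  by_cases hsmall : m ≤ 2 * k
  · refine SimpleGraph.exists_isCycle_of_card_lt (β := k) (x := 1) hn3 hk1 (by omega) le_rfl
      (by simp) le_rfl Finset.univ (fun I _ => hα I) ?_
    rw [hu, Nat.add_sub_cancel]
    have h1 : m * (k + 2) * k ≤ 2 * k * (3 * k) * k :=
      Nat.mul_le_mul_right _ (Nat.mul_le_mul hsmall (by omega))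
    have h2 : 2 * k * (3 * k) * k = 6 * (k * k * k) := by ring
    omega
  · refine SimpleGraph.exists_isCycle_of_card_lt (β := 2) (x := k) hn3 (by omega) (by omega) hk1
      Nat.lt_two_pow_self.le le_rfl Finset.univ (fun I _ => hα I) ?_
    rw [hu, Nat.add_sub_cancel]
    have h1 : m * (2 + 2) * k ≤ 8 * (k * k) * (2 + 2) * k :=
      Nat.mul_le_mul_right _ (Nat.mul_le_mul_right _ (by omega))
    have h2 : 8 * (k * k) * (2 + 2) * k = 32 * (k * k * k) := by ring
    omega
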